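/- Let $\kappa$ be an infinite regular cardinal. A diagram is $\kappa$-small if its index category has fewer than $\kappa$ morphisms; a category is $\kappa$-lex if it has all $\kappa$-small limits, and a functor is $\kappa$-lex if it preserves them. A category is regular if it has finite limits, kernel pairs have coequalizers, and regular (equivalently, effective) epimorphisms are stable under pullback; a functor is regular if it preserves finite limits and regular epimorphisms. For a small category $\mathcal{C}$ let $\mathbf{Lex}_\kappa(\mathcal{C},\mathbf{Set})$ be the full subcategory of $\mathbf{Set}^{\mathcal{C}}$ on the $\kappa$-lex functors, and let $Pro_\kappa(\mathcal{C})$ be the full subcategory of $(\mathbf{Set}^{\mathcal{C}})^{op}$ on the small $\kappa$-filtered colimits (formed in $\mathbf{Set}^{\mathcal{C}}$) of representable functors $\mathcal{C}(x,-)$. Theorem. Let $\mathcal{C}$ be a small category that is $\kappa$-lex and regular. Then $\mathbf{Lex}_\kappa(\mathcal{C},\mathbf{Set})^{op} = Pro_\kappa(\mathcal{C})$ as full subcategories of $(\mathbf{Set}^{\mathcal{C}})^{op}$, this category is $\kappa$-lex and regular, and the Yoneda embedding $Y:\mathcal{C}\hookrightarrow \mathbf{Lex}_\kappa(\mathcal{C},\mathbf{Set})^{op}$,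 $x\mapsto \mathcal{C}(x,-)$, is fully faithful, $\kappa$-lex and regular. -/

import Mathlib

open CategoryTheory CategoryTheory.Limits Opposite

universe w v u v' u'

namespace KappaLex

/-- The category `C` is `κ`-lex: it has all `κ`-small limits, i.e. limits of all diagrams
indexed by a category with fewer than `κ` morphisms. -/
def IsLexCategory (κ : Cardinal.{w}) (C : Type u) [Category.{v} C] : Prop :=
  ∀ (J : Type w) [SmallCategory J], HasCardinalLT (Arrow J) κ → HasLimitsOfShape J C

/-- The functor `F` is `κ`-lex: it preserves all `κ`-small limits. -/
def IsLexFunctor (κ : Cardinal.{w}) {C : Type u} [Category.{v} C] {D : Type u'} [Category.{v'} D]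
    (F : C ⥤ D) : Prop :=
  ∀ (J : Type w) [SmallCategory J], HasCardinalLT (Arrow J) κ → PreservesLimitsOfShape J F

/-- The functor `F` is regular: it preserves finite limits and regular (equivalently, in the
presence of kernel pairs, effective) epimorphisms. -/
structure IsRegularFunctor {C : Type u} [Category.{v} C] {D : Type u'} [Category.{v'} D]
    (F : C ⥤ D) : Prop where
  preservesFiniteLimits : PreservesFiniteLimits F
  map_isRegularEpi : ∀ {X Y : C} (f : X ⟶ Y), IsRegularEpi f → IsRegularEpi (F.map f)

/-- The property of being a `κ`-lex functor from `C` to sets. -/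
def lexProperty (κ : Cardinal.{w}) (C : Type w) [SmallCategory C] :
    ObjectProperty (C ⥤ Type w) :=
  fun F ↦ IsLexFunctor κ F

/-- The category `Lex_κ(C, Set)` of `κ`-lex functors from `C` to sets and all natural
transformations between them. -/
abbrev Lex (κ : Cardinal.{w}) (C : Type w) [SmallCategory C] : Type (w + 1) :=
  (lexProperty κ C).FullSubcategory

/-- The functor `F : C ⥤ Set` is a (small) `κ`-filtered colimit of representable functors
`C(x, -)`; in other words, as an object of `(C ⥤ Set)ᵒᵖ` it is a `κ`-cofiltered limit of objects
of `C`. The category `Pro_κ(C)` of `κ`-pro-objects is the full subcategory of `(C ⥤ Set)ᵒᵖ` on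
these functors. -/
def proProperty (κ : Cardinal.{w}) [Fact κ.IsRegular] (C : Type w) [SmallCategory C] :
    ObjectProperty (C ⥤ Type w) :=
  fun F ↦ ∃ (J : Type w) (_ : SmallCategory J) (_ : IsCardinalFiltered J κ)
    (D : J ⥤ Cᵒᵖ) (ι : D ⋙ coyoneda ⟶ (Functor.const J).obj F),
      Nonempty (IsColimit (Cocone.mk F ι))

/-- The category `Pro_κ(C)`. -/
abbrev Pro (κ : Cardinal.{w}) [Fact κ.IsRegular] (C : Type w) [SmallCategory C] : Type (w + 1) :=
  ((proProperty κ C).FullSubcategory)ᵒᵖ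

theorem lexProperty_coyoneda (κ : Cardinal.{w}) (C : Type w) [SmallCategory C] (X : Cᵒᵖ) :
    lexProperty κ C (coyoneda.obj X) :=
  fun _ _ _ ↦ inferInstance

theorem proProperty_coyoneda (κ : Cardinal.{w}) [Fact κ.IsRegular] (C : Type w) [SmallCategory C]
    (X : Cᵒᵖ) : proProperty κ C (coyoneda.obj X) := by
  let F : Discrete PUnit.{w + 1} ⥤ Cᵒᵖ := (Functor.const _).obj X
  refine ⟨Discrete PUnit.{w + 1}, inferInstance, ⟨fun G _ ↦ ⟨⟨⟨⟨⟩⟩, ?_⟩⟩⟩, F,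
    { app := fun _ ↦ 𝟙 _ }, ⟨{ desc := fun s ↦ s.ι.app ⟨⟨⟩⟩ }⟩⟩
  exact { app := fun _ ↦ eqToHom (Subsingleton.elim _ _) }

/-- The Yoneda embedding `C ⥤ Lex_κ(C, Set)ᵒᵖ`, `x ↦ C(x, -)`. -/
def yonedaLex (κ : Cardinal.{w}) (C : Type w) [SmallCategory C] : C ⥤ (Lex κ C)ᵒᵖ :=
  ((lexProperty κ C).lift coyoneda (lexProperty_coyoneda κ C)).rightOp

/-- The Yoneda embedding `C ⥤ Pro_κ(C)`, `x ↦ C(x, -)`. -/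
def yonedaPro (κ : Cardinal.{w}) [Fact κ.IsRegular] (C : Type w) [SmallCategory C] :
    C ⥤ Pro κ C :=
  ((proProperty κ C).lift coyoneda (proProperty_coyoneda κ C)).rightOp

end KappaLex

/-!
Write `L` for `Lex κ C`.

*`Lex` equals `Pro`, and `L` is reflective.* A functor `F` preserves the limit of `E : K ⥤ C` iff
it is local with respect to the comparison map `colim_k C(E k, -) ⟶ C(lim E, -)`
(`bijective_limComparison_comp_iff`). For `K` ranging over a set of representatives of the
`κ`-small categories this is a small set of maps between `κ`-presentable functors, so that `L` is
closed under `κ`-filtered colimits and reflective in `C ⥤ Type w`. This gives `Pro ⊆ Lex`, as well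
as limits and colimits in `L`. Conversely, any `F` is the colimit of representables over the
opposite of its category of elements, and that category is `κ`-filtered if `F` is `κ`-lex.

*Regular epimorphisms of `Lᵒᵖ`.* The heart of the proof is the elementwise notion `IsImmersion`:
`f : F ⟶ G` is an immersion if the naturality squares of `f` at monomorphisms `m : X ⟶ Y` of `C`
are weak pullbacks, i.e. if `a ∈ F Y` and `f a` comes from `G X`, then `a` comes from `F X`. A
morphism of `Lᵒᵖ` is a regular epimorphism iff the corresponding morphism of `L` is an immersion
(`isRegularEpi_iff_isImmersion`). One direction is the lifting property of a strong epimorphism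
against the monomorphism `Y(m)` of `Lᵒᵖ`.

For the other direction and for the stability under pullback, a span `G ⟵ F ⟶ H` in `L` is
completed to a square with a vertex `amalgam f h` in `L`, the filtered colimit of `C(A ×_Z B, -)`
over all cospans `A ⟶ Z ⟵ B` in `C` with compatible elements of `H A`, `F Z` and `G B`. If
`f : F ⟶ G` is an immersion, then the elements of `F Z` can be lifted along the image of
`B ⟶ Z`, so that `B ⟶ Z` may be assumed to be a regular epimorphism. Stability of regular
epimorphisms under pullback in `C` now shows that `H ⟶ amalgam f h` is an immersion (`IsImmersion.amalgam_inl`), and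
that, when `h = f`, the map `f` is the equalizer of the two maps `G ⟶ amalgam f f`
(`IsImmersion.exists_of_inl_app_eq_inr_app`). That the amalgam is a pushout is never needed: as
immersions are left cancellable (`IsImmersion.of_comp`), the map from `H` to the actual pushout is
an immersion as soon as `H ⟶ amalgam f h` is one.
-/

namespace KappaLex

/-! ### Lex functors as local objects -/

section LocalObjects

variable {C : Type w} [SmallCategory C]

instance (κ : Cardinal.{w}) [Fact κ.IsRegular] (X : Cᵒᵖ) :
    IsCardinalPresentable (coyoneda.obj X : C ⥤ Type w) κ where
  preservesColimitOfShape J _ _ := by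
    let e : coyoneda.obj (op (coyoneda.obj X : C ⥤ Type w)) ≅ (evaluation C (Type w)).obj X.unop :=
      NatIso.ofComponents (fun F ↦ (coyonedaEquiv (X := X.unop) (F := F)).toIso)
        (fun f ↦ by ext x; exact coyonedaEquiv_comp _ _)
    exact preservesColimitsOfShape_of_natIso e.symm

/-- The canonical map `colim_k C(E k, -) ⟶ C(lim E, -)`. -/
noncomputable def limComparison {K : Type w} [SmallCategory K] (E : K ⥤ C) [HasLimit E] :
    colimit (E.op ⋙ coyoneda) ⟶ coyoneda.obj (op (limit E)) :=
  colimit.desc (E.op ⋙ coyoneda) (coyoneda.mapCocone (limit.cone E).op)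

/-- By the Yoneda lemma, composition with `limComparison E` is the map from `F (lim E)` to the
compatible families of elements of the sets `F (E k)`. -/
lemma bijective_limComparison_comp_iff {K : Type w} [SmallCategory K] (E : K ⥤ C) [HasLimit E]
    (F : C ⥤ Type w) :
    Function.Bijective (fun g : coyoneda.obj (op (limit E)) ⟶ F ↦ limComparison E ≫ g) ↔
      PreservesLimit E F := by
  let e₂ : (colimit (E.op ⋙ coyoneda) ⟶ F) ≃ (E ⋙ F).sections :=
    { toFun g := ⟨fun k ↦ coyonedaEquiv (X := E.obj k) (F := F)
          (colimit.ι (E.op ⋙ coyoneda) (op k) ≫ g), fun {k k'} φ ↦ by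
        dsimp only
        rw [← colimit.w (E.op ⋙ coyoneda) φ.op]
        exact coyonedaEquiv_naturality (X := E.obj k) (F := F)
          (colimit.ι (E.op ⋙ coyoneda) (op k) ≫ g) (E.map φ)⟩
      invFun s := colimit.desc (E.op ⋙ coyoneda)
        { pt := F
          ι :=
            { app k := coyonedaEquiv.symm (s.1 k.unop)
              naturality {k k'} φ := by
                have h := s.2 φ.unop
                dsimp at h ⊢
                rw [Category.comp_id, ← h]
                exact (coyonedaEquiv_symm_map (E.map φ.unop) _).symm } }
      left_inv g := by
        refine colimit.hom_ext fun k ↦ ?_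
        rw [colimit.ι_desc]
        exact coyonedaEquiv.symm_apply_apply _
      right_inv s := by
        ext k
        dsimp only
        rw [colimit.ι_desc]
        exact coyonedaEquiv.apply_symm_apply _ }
  have key : ∀ g : coyoneda.obj (op (limit E)) ⟶ F,
      e₂ (limComparison E ≫ g) =
        Types.sectionOfCone (F.mapCone (limit.cone E)) (coyonedaEquiv g) := by
    intro g
    ext k
    simp only [e₂, limComparison, Equiv.coe_fn_mk, colimit.ι_desc_assoc]
    exact (coyonedaEquiv_naturality g (limit.π E k)).symm
  have : Function.Bijective (fun g : coyoneda.obj (op (limit E)) ⟶ F ↦ limComparison E ≫ g) ↔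
      Function.Bijective (Types.sectionOfCone (F.mapCone (limit.cone E))) := by
    rw [← e₂.bijective.of_comp_iff',
      ← (coyonedaEquiv (X := limit E) (F := F)).bijective.of_comp_iff]
    exact iff_of_eq (congrArg _ (funext key))
  rw [this, ← Types.isLimit_iff_bijective_sectionOfCone]
  exact ⟨fun ⟨h⟩ ↦ preservesLimit_of_preserves_limit_cone (limit.isLimit E) h,
    fun _ ↦ ⟨isLimitOfPreserves F (limit.isLimit E)⟩⟩

section

variable {κ : Cardinal.{w}} (hC : IsLexCategory κ C)

include hC in
lemma IsLexCategory.hasLimit (i : Σ S : SmallCategoryCardinalLT κ,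
    SmallCategoryCardinalLT.categoryFamily κ S ⥤ C) : HasLimit i.2 :=
  have := hC _ i.1.hasCardinalLT
  inferInstance

/-- The maps `limComparison E`, for the diagrams `E` indexed by a representative set of the
`κ`-small categories. The representatives make this a small family. -/
def limComparisons : MorphismProperty (C ⥤ Type w) :=
  have := hC.hasLimit
  MorphismProperty.ofHoms (ι := Σ S : SmallCategoryCardinalLT κ,
    SmallCategoryCardinalLT.categoryFamily κ S ⥤ C) (fun i ↦ limComparison i.2)

instance : MorphismProperty.IsSmall.{w} (limComparisons hC) := by
  unfold limComparisons
  infer_instance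

lemma isLocal_limComparisons : (limComparisons hC).isLocal = lexProperty κ C := by
  ext F
  have h : (limComparisons hC).isLocal F ↔ ∀ i : (Σ S : SmallCategoryCardinalLT κ,
      SmallCategoryCardinalLT.categoryFamily κ S ⥤ C), PreservesLimit i.2 F := by
    refine ⟨fun h i ↦ ?_, fun h _ _ _ hf ↦ ?_⟩
    · have := hC.hasLimit i
      exact (bijective_limComparison_comp_iff i.2 F).1 (h _ ⟨i⟩)
    · obtain ⟨i⟩ := hf
      have := hC.hasLimit i
      exact (bijective_limComparison_comp_iff i.2 F).2 (h i)
  rw [h]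
  refine ⟨fun h J _ hJ ↦ ?_, fun h i ↦ ?_⟩
  · obtain ⟨S, ⟨e⟩⟩ := SmallCategoryCardinalLT.exists_equivalence κ J hJ
    have : PreservesLimitsOfShape (SmallCategoryCardinalLT.categoryFamily κ S) F :=
      ⟨fun {E} ↦ h ⟨S, E⟩⟩
    exact preservesLimitsOfShape_of_equiv e F
  · have := h _ i.1.hasCardinalLT
    infer_instance

lemma isCardinalPresentable_of_limComparisons [Fact κ.IsRegular] ⦃X Y : C ⥤ Type w⦄ (f : X ⟶ Y)
    (hf : limComparisons hC f) : IsCardinalPresentable X κ ∧ IsCardinalPresentable Y κ := by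
  obtain ⟨i⟩ := hf
  refine ⟨?_, inferInstance⟩
  have (k : (SmallCategoryCardinalLT.categoryFamily κ i.1)ᵒᵖ) :
      IsCardinalPresentable ((i.2.op ⋙ coyoneda).obj k) κ :=
    inferInstanceAs (IsCardinalPresentable (coyoneda.obj (op (i.2.obj k.unop))) κ)
  exact isCardinalPresentable_of_isColimit _ (colimit.isColimit (i.2.op ⋙ coyoneda)) κ
    (by simpa using i.1.hasCardinalLT)

variable [Fact κ.IsRegular]

include hC

lemma isRightAdjoint_ι_lexProperty : (lexProperty κ C).ι.IsRightAdjoint := by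
  rw [← isLocal_limComparisons hC]
  exact MorphismProperty.isRightAdjoint_ι_isLocal _ κ (isCardinalPresentable_of_limComparisons hC)

lemma nonempty_reflective_ι_lexProperty : Nonempty (Reflective (lexProperty κ C).ι) :=
  have := isRightAdjoint_ι_lexProperty hC
  ⟨{ L := (lexProperty κ C).ι.leftAdjoint
     adj := Adjunction.ofIsRightAdjoint _ }⟩

lemma hasColimitsOfSize_lex : HasColimitsOfSize.{w, w} (Lex κ C) := by
  obtain ⟨_⟩ := nonempty_reflective_ι_lexProperty hC
  exact ⟨fun _ ↦ hasColimitsOfShape_of_reflective (lexProperty κ C).ι⟩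

lemma hasLimitsOfSize_lex : HasLimitsOfSize.{w, w} (Lex κ C) := by
  obtain ⟨_⟩ := nonempty_reflective_ι_lexProperty hC
  exact ⟨fun _ ↦ hasLimitsOfShape_of_reflective (lexProperty κ C).ι⟩

lemma proProperty_le_lexProperty : proProperty κ C ≤ lexProperty κ C := by
  rintro F ⟨J, _, _, D, ι, ⟨hF⟩⟩
  have := (limComparisons hC).isClosedUnderColimitsOfShape_isLocal J κ
    (isCardinalPresentable_of_limComparisons hC)
  rw [isLocal_limComparisons hC] at this
  exact (lexProperty κ C).prop_of_isColimit hF fun j ↦ lexProperty_coyoneda κ C (D.obj j)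

lemma isLexCategory_op_lex : IsLexCategory κ (Lex κ C)ᵒᵖ := fun _ _ _ ↦
  have := hasColimitsOfSize_lex hC
  inferInstance

end

section

variable {κ : Cardinal.{w}} [Fact κ.IsRegular]

/-- The category of elements of a `κ`-lex functor has `κ`-small limits, hence it is
`κ`-cofiltered. -/
lemma isCardinalFiltered_op_elements {C : Type u} [Category.{v} C] (hC : IsLexCategory κ C)
    {F : C ⥤ Type w} (hF : IsLexFunctor κ F) : IsCardinalFiltered F.Elementsᵒᵖ κ where
  nonempty_cocone {A} _ E hA := by
    have hA' : HasCardinalLT (Arrow Aᵒᵖ) κ := by simpa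
    have := hC _ hA'
    have := hF _ hA'
    exact ⟨coconeOfConeLeftOp (limit.cone E.leftOp)⟩

/-- A functor `F : C ⥤ Type w` as a cocone over the representables `C(X, -)` indexed by the pairs
`(X, a)` with `a ∈ F X`, the element `a` being viewed as a map `C(X, -) ⟶ F`. -/
def elementsCocone (F : C ⥤ Type w) : Cocone ((CategoryOfElements.π F).op ⋙ coyoneda) where
  pt := F
  ι :=
    { app p := coyonedaEquiv.symm p.unop.2
      naturality p q φ := by
        have h := φ.unop.2
        dsimp at h ⊢
        rw [Category.comp_id, ← h]
        exact (coyonedaEquiv_symm_map φ.unop.1 _).symm }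

/-- Every functor `F : C ⥤ Type w` is the colimit of representables over its elements. -/
def isColimitElementsCocone (F : C ⥤ Type w) : IsColimit (elementsCocone F) where
  desc s :=
    { app X := ↾fun a ↦ coyonedaEquiv (X := X) (s.ι.app (op ⟨X, a⟩))
      naturality X Y f := by
        ext a
        have h := s.w (Quiver.Hom.op (CategoryOfElements.homMk ⟨X, a⟩ ⟨Y, F.map f a⟩ f rfl))
        exact (congrArg coyonedaEquiv h.symm).trans
          (coyonedaEquiv_naturality (s.ι.app (op ⟨X, a⟩)) f).symm }
  fac s p := by
    apply coyonedaEquiv.injective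
    refine (coyonedaEquiv_comp _ _).trans ?_
    exact congrArg (fun y ↦ coyonedaEquiv (s.ι.app (op ⟨p.unop.1, y⟩)))
      (coyonedaEquiv.apply_symm_apply p.unop.2)
  uniq s m hm := by
    ext X a
    exact ((congrArg coyonedaEquiv (hm (op ⟨X, a⟩))).symm.trans ((coyonedaEquiv_comp _ _).trans
      (congrArg (m.app X) ((coyonedaEquiv (F := F)).apply_symm_apply a)))).symm

lemma lexProperty_le_proProperty (hC : IsLexCategory κ C) : lexProperty κ C ≤ proProperty κ C :=
  fun F hF ↦ ⟨F.Elementsᵒᵖ, inferInstance, isCardinalFiltered_op_elements hC hF,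
    (CategoryOfElements.π F).op, (elementsCocone F).ι, ⟨isColimitElementsCocone F⟩⟩

lemma lexProperty_eq_proProperty (hC : IsLexCategory κ C) : lexProperty κ C = proProperty κ C :=
  le_antisymm (lexProperty_le_proProperty hC) (proProperty_le_lexProperty hC)

end

end LocalObjects

/-! ### The Yoneda embedding and immersions -/

section Immersions

variable {κ : Cardinal.{w}} [Fact κ.IsRegular]

lemma IsLexFunctor.preservesFiniteLimits {C : Type u} [Category.{v} C] {D : Type u'}
    [Category.{v'} D] {F : C ⥤ D} (hF : IsLexFunctor κ F) : PreservesFiniteLimits F :=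
  preservesFiniteLimits_of_preservesFiniteLimitsOfSize.{w} F fun J _ _ ↦
    hF J (HasCardinalLT.of_le (by rw [hasCardinalLT_aleph0_iff]; infer_instance)
      (Cardinal.IsRegular.aleph0_le Fact.out))

section Yoneda

variable {C : Type w} [SmallCategory C]

instance (F : Lex κ C) : PreservesFiniteLimits F.obj :=
  F.property.preservesFiniteLimits

instance : (yonedaLex κ C).Full := by
  unfold yonedaLex
  infer_instance

instance : (yonedaLex κ C).Faithful := by
  unfold yonedaLex
  infer_instance

/-- The Yoneda lemma: morphisms from `F` to `C(X, -)` in `Lex_κ(C, Set)ᵒᵖ` are elements of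
`F X`. -/
def yonedaLexEquiv {F : Lex κ C} {X : C} : (op F ⟶ (yonedaLex κ C).obj X) ≃ F.obj.obj X :=
  (opEquiv _ _).trans ((lexProperty κ C).fullyFaithfulι.homEquiv.trans coyonedaEquiv)

omit [Fact κ.IsRegular] in
lemma yonedaLexEquiv_comp_map {F : Lex κ C} {X Y : C} (g : op F ⟶ (yonedaLex κ C).obj X)
    (f : X ⟶ Y) :
    yonedaLexEquiv (g ≫ (yonedaLex κ C).map f) = F.obj.map f (yonedaLexEquiv g) :=
  (coyonedaEquiv_naturality (X := X) (F := F.obj) g.unop.hom f).symm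

omit [Fact κ.IsRegular] in
lemma yonedaLexEquiv_comp {F G : Lex κ C} {X : C} (g : op F ⟶ (yonedaLex κ C).obj X)
    (f : op G ⟶ op F) :
    yonedaLexEquiv (f ≫ g) = f.unop.hom.app X (yonedaLexEquiv g) :=
  coyonedaEquiv_comp (X := X) g.unop.hom f.unop.hom

omit [Fact κ.IsRegular] in
/-- A functor preserves a limit if its composites with all the functors `Hom(F, -)` do; for the
Yoneda embedding these composites are the `κ`-lex functors `F` themselves. -/
lemma isLexFunctor_yonedaLex : IsLexFunctor κ (yonedaLex κ C) := fun J _ hJ ↦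
  ⟨fun {E} ↦ ⟨fun {c} hc ↦ ⟨coyonedaJointlyReflectsLimits _ _ fun F ↦ by
    let e : yonedaLex κ C ⋙ coyoneda.obj F ≅ F.unop.unop.obj :=
      NatIso.ofComponents (fun X ↦ yonedaLexEquiv.toIso)
        (fun f ↦ by ext g; exact yonedaLexEquiv_comp_map g f)
    have := F.unop.unop.property J hJ
    have := preservesLimitsOfShape_of_natIso (J := J) e.symm
    exact isLimitOfPreserves (yonedaLex κ C ⋙ coyoneda.obj F) hc⟩⟩⟩

end Yoneda

lemma exists_of_isPullback {C : Type u} [Category.{v} C] (F : C ⥤ Type w)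
    [PreservesFiniteLimits F] {P X Y Z : C} {fst : P ⟶ X} {snd : P ⟶ Y} {f : X ⟶ Z} {g : Y ⟶ Z}
    (h : IsPullback fst snd f g) (a : F.obj X) (b : F.obj Y) (hab : F.map f a = F.map g b) :
    ∃ c : F.obj P, F.map fst c = a ∧ F.map snd c = b := by
  exact Types.exists_of_isPullback (h.map F) a b hab

lemma map_injective_of_mono {C : Type u} [Category.{v} C] (F : C ⥤ Type w)
    [PreservesFiniteLimits F] {X Y : C} (m : X ⟶ Y) [Mono m] : Function.Injective (F.map m) :=
  (mono_iff_injective _).1 inferInstance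

section Immersion

variable {C : Type u} [Category.{v} C] {F G H : C ⥤ Type w}

/-- A natural transformation `f : F ⟶ G` is an immersion if it reflects the image of every
monomorphism `m : X ⟶ Y`: an element of `F Y` lies in the image of `F X` as soon as its image in
`G Y` lies in the image of `G X`. Between lex functors, this says that the naturality squares of
`f` at monomorphisms are pullbacks. -/
def IsImmersion (f : F ⟶ G) : Prop :=
  ∀ ⦃X Y : C⦄ (m : X ⟶ Y) [Mono m] (a : F.obj Y) (b : G.obj X), f.app Y a = G.map m b →
    ∃ a' : F.obj X, F.map m a' = a

lemma IsImmersion.of_comp {f : F ⟶ G} {g : G ⟶ H} (h : IsImmersion (f ≫ g)) : IsImmersion f :=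
  fun _ _ m _ a b hab ↦ h m a (g.app _ b) (by simp [hab])

/-- Two elements of `F X` are the images of one element `c` under two maps `p₁` and `p₂` in `C`;
they are equal iff `c` comes from the equalizer of `p₁` and `p₂`, which is a monomorphism. -/
lemma IsImmersion.injective {f : F ⟶ G} (h : IsImmersion f) [HasFiniteLimits C]
    [PreservesFiniteLimits F] [PreservesFiniteLimits G] (X : C) :
    Function.Injective (f.app X) := by
  intro a₁ a₂ ha
  obtain ⟨Y, p₁, p₂, c, rfl, rfl⟩ : ∃ (Y : C) (p₁ p₂ : Y ⟶ X) (c : F.obj Y),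
      F.map p₁ c = a₁ ∧ F.map p₂ c = a₂ :=
    let x₁ : F.Elements := ⟨X, a₁⟩
    let x₂ : F.Elements := ⟨X, a₂⟩
    let p₁ : x₁ ⨯ x₂ ⟶ x₁ := prod.fst
    let p₂ : x₁ ⨯ x₂ ⟶ x₂ := prod.snd
    ⟨_, p₁.1, p₂.1, _, p₁.2, p₂.2⟩
  obtain ⟨b, hb, -⟩ := Types.unique_of_type_equalizer _ _
    (isLimitForkMapOfIsLimit G (equalizer.condition p₁ p₂) (equalizerIsEqualizer p₁ p₂))
    (f.app _ c) (by rw [← NatTrans.naturality_apply, ← NatTrans.naturality_apply, ha])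
  obtain ⟨c, rfl⟩ := h (equalizer.ι p₁ p₂) c b hb.symm
  rw [← comp_apply, ← comp_apply, ← F.map_comp, ← F.map_comp, equalizer.condition]

end Immersion

section

variable {C : Type w} [SmallCategory C]

/-- The Yoneda embedding preserves monomorphisms, and a strong epimorphism `X ⟶ Y` in
`Lex_κ(C, Set)ᵒᵖ` has the lifting property with respect to them. Squares from `f` to the image of
`m : V ⟶ W` are pairs of elements `b` and `a` of the functors `X` and `Y` at `V` and `W` with the same
image in the functor `X` at `W`. -/
lemma isImmersion_of_strongEpi [HasFiniteLimits C] {X Y : (Lex κ C)ᵒᵖ} (f : X ⟶ Y) [StrongEpi f] :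
    IsImmersion f.unop.hom := by
  intro V W m _ a b hab
  have := (isLexFunctor_yonedaLex (κ := κ) (C := C)).preservesFiniteLimits
  let t : X ⟶ (yonedaLex κ C).obj V := yonedaLexEquiv.symm b
  let s : Y ⟶ (yonedaLex κ C).obj W := yonedaLexEquiv.symm a
  have sq : CommSq t f ((yonedaLex κ C).map m) s := ⟨by
    apply yonedaLexEquiv.injective
    rw [yonedaLexEquiv_comp_map]
    refine Eq.trans ?_ (yonedaLexEquiv_comp s f).symm
    simp only [t, s, Equiv.apply_symm_apply, hab]⟩
  refine ⟨yonedaLexEquiv (F := Y.unop) sq.lift, ?_⟩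
  rw [← yonedaLexEquiv_comp_map]
  exact (congrArg _ sq.fac_right).trans (yonedaLexEquiv.apply_symm_apply a)

end

section Regular

variable {C : Type u} [Category.{v} C]

lemma exists_lift_of_comp_eq {X Y V W : C} (e : X ⟶ Y) [IsRegularEpi e] (m : V ⟶ W) [Mono m]
    (k : X ⟶ V) (r : Y ⟶ W) (h : k ≫ m = e ≫ r) : ∃ s : Y ⟶ V, s ≫ m = r :=
  have sq : CommSq k e m r := ⟨h⟩
  ⟨sq.lift, sq.fac_right⟩

/-- In a regular category, two maps `p : X ⟶ W` and `q : Y ⟶ W` that agree on the pullback of two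
regular epimorphisms `s : X ⟶ Z` and `t : Y ⟶ Z` descend to `Z`. -/
lemma exists_desc_of_pullback [Regular C] {X Y Z W : C} (s : X ⟶ Z) (t : Y ⟶ Z) [IsRegularEpi s]
    [IsRegularEpi t] (p : X ⟶ W) (q : Y ⟶ W)
    (h : pullback.fst s t ≫ p = pullback.snd s t ≫ q) : ∃ r : Z ⟶ W, s ≫ r = p := by
  have hp : pullback.fst s s ≫ p = pullback.snd s s ≫ p := by
    have key (i : pullback s s ⟶ X) (hi : i ≫ s = pullback.fst s s ≫ s) :
        pullback.fst (pullback.fst s s ≫ s) t ≫ i ≫ p =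
          pullback.snd (pullback.fst s s ≫ s) t ≫ q := by
      have := pullback.lift (pullback.fst (pullback.fst s s ≫ s) t ≫ i)
        (pullback.snd (pullback.fst s s ≫ s) t)
        (by rw [Category.assoc, hi]; exact pullback.condition) ≫= h
      rwa [pullback.lift_fst_assoc, pullback.lift_snd_assoc, Category.assoc] at this
    rw [← cancel_epi (pullback.fst (pullback.fst s s ≫ s) t), key _ rfl,
      key _ pullback.condition.symm]
  let d := Cofork.IsColimit.desc' (IsKernelPair.of_hasPullback s).toCoequalizer' p hp
  exact ⟨d.1, d.2⟩

lemma exists_isRegularEpi_comp_mono [Regular C] {X Y : C} (f : X ⟶ Y) :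
    ∃ (I : C) (e : X ⟶ I) (m : I ⟶ Y), IsRegularEpi e ∧ Mono m ∧ e ≫ m = f :=
  let φ := Regular.strongEpiMonoFactorisation f
  ⟨φ.I, φ.e, φ.m, inferInstanceAs (IsRegularEpi (Regular.strongEpiMonoFactorisation f).e),
    inferInstance, φ.fac⟩

end Regular

end Immersions

/-! ### Amalgamation of a span of lex functors -/

lemma IsLexCategory.functor {κ : Cardinal.{w}} {C : Type u} [Category.{v} C]
    (hC : IsLexCategory κ C) (D : Type u') [Category.{v'} D] : IsLexCategory κ (D ⥤ C) :=
  fun J _ hJ ↦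
    have := hC J hJ
    inferInstance

section

variable {C : Type u} [Category.{v} C] {F G H : C ⥤ Type w} (f : F ⟶ G) (h : F ⟶ H)

/-- For a span `G ⟵ F ⟶ H` of functors, the functor sending a cospan `A ⟶ Z ⟵ B` in `C` to the set
of triples in `H A × F Z × G B` such that the components in `H A` and `F Z` agree in `H Z`, and
those in `F Z` and `G B` agree in `G Z`. -/
@[simps]
def cospanElements : (WalkingCospan ⥤ C) ⥤ Type w where
  obj D := { p : H.obj (D.obj .left) × F.obj (D.obj .one) × G.obj (D.obj .right) //
    H.map (D.map WalkingCospan.Hom.inl) p.1 = h.app _ p.2.1 ∧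
      G.map (D.map WalkingCospan.Hom.inr) p.2.2 = f.app _ p.2.1 }
  map {D D'} φ := ↾fun p ↦ ⟨(H.map (φ.app .left) p.1.1, F.map (φ.app .one) p.1.2.1,
    G.map (φ.app .right) p.1.2.2), by
      constructor
      · rw [NatTrans.naturality_apply, ← p.2.1, ← comp_apply, ← comp_apply, ← H.map_comp,
          ← H.map_comp, φ.naturality]
      · rw [NatTrans.naturality_apply, ← p.2.2, ← comp_apply, ← comp_apply, ← G.map_comp,
          ← G.map_comp, φ.naturality]⟩
  map_id D := by ext p <;> simp
  map_comp φ ψ := by ext p <;> simp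

variable {f h}

/-- Limits of cospans are computed pointwise, and so are the compatibility conditions. -/
lemma isLexFunctor_cospanElements {κ : Cardinal.{w}} (hC : IsLexCategory κ C)
    (hF : IsLexFunctor κ F) (hG : IsLexFunctor κ G) (hH : IsLexFunctor κ H) :
    IsLexFunctor κ (cospanElements f h) := fun J _ hJ ↦ ⟨fun {E} ↦ ⟨fun {c} hc ↦ by
  have := hC J hJ
  have := hF J hJ
  have := hG J hJ
  have := hH J hJ
  have key (K : C ⥤ Type w) [PreservesLimitsOfShape J K] (i : WalkingCospan) :=
    (Types.isLimit_iff _).1 ⟨isLimitOfPreserves ((evaluation WalkingCospan C).obj i ⋙ K) hc⟩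
  rw [Types.isLimit_iff]
  intro s hs
  obtain ⟨a, ha, ha'⟩ := key H .left (fun j ↦ (s j).1.1)
    (fun φ ↦ congrArg (fun p ↦ p.1.1) (hs φ))
  obtain ⟨x, hx, hx'⟩ := key F .one (fun j ↦ (s j).1.2.1)
    (fun φ ↦ congrArg (fun p ↦ p.1.2.1) (hs φ))
  obtain ⟨b, hb, hb'⟩ := key G .right (fun j ↦ (s j).1.2.2)
    (fun φ ↦ congrArg (fun p ↦ p.1.2.2) (hs φ))
  have ext (K : C ⥤ Type w) [PreservesLimitsOfShape J K] (y z : K.obj (c.pt.obj .one))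
      (hyz : ∀ j, K.map ((c.π.app j).app .one) y = K.map ((c.π.app j).app .one) z) : y = z :=
    (key K .one (fun j ↦ K.map ((c.π.app j).app .one) z) (fun {j j'} φ ↦ by
      dsimp
      rw [← comp_apply, ← K.map_comp, ← NatTrans.comp_app, c.w])).unique hyz (fun _ ↦ rfl)
  refine ⟨⟨(a, x, b), ext H _ _ fun j ↦ ?_, ext G _ _ fun j ↦ ?_⟩, fun j ↦ ?_, ?_⟩
  · have h₁ := ha j
    have h₂ := hx j
    have h₃ := (s j).2.1
    dsimp at h₁ h₂ h₃ ⊢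
    rw [← NatTrans.naturality_apply, h₂, ← h₃, ← h₁, ← comp_apply, ← comp_apply, ← H.map_comp,
      ← H.map_comp, NatTrans.naturality]
  · have h₁ := hb j
    have h₂ := hx j
    have h₃ := (s j).2.2
    dsimp at h₁ h₂ h₃ ⊢
    rw [← NatTrans.naturality_apply, h₂, ← h₃, ← h₁, ← comp_apply, ← comp_apply, ← G.map_comp,
      ← G.map_comp, NatTrans.naturality]
  · exact Subtype.ext (Prod.ext (ha j) (Prod.ext (hx j) (hb j)))
  · intro y hy
    exact Subtype.ext (Prod.ext (ha' _ fun j ↦ congrArg (fun p ↦ p.1.1) (hy j))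
      (Prod.ext (hx' _ fun j ↦ congrArg (fun p ↦ p.1.2.1) (hy j))
        (hb' _ fun j ↦ congrArg (fun p ↦ p.1.2.2) (hy j))))⟩⟩

end

section

variable {C : Type w} [SmallCategory C] [HasFiniteLimits C] {F G H : C ⥤ Type w}
  (f : F ⟶ G) (h : F ⟶ H)

/-- The colimit of the functors `C(A ×_Z B, -)`, indexed by the cospans `A ⟶ Z ⟵ B` equipped with
compatible elements of `H A`, `F Z` and `G B`. For `κ`-lex functors on a `κ`-lex category this is
the pushout of `G` and `H` under `F` in `Lex_κ(C, Set)`; only the commutative square and the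
description of its elements are used. -/
noncomputable def amalgam : C ⥤ Type w :=
  colimit ((CategoryOfElements.π (cospanElements f h) ⋙ lim).op ⋙ coyoneda)

lemma lexProperty_amalgam {κ : Cardinal.{w}} [Fact κ.IsRegular] (hC : IsLexCategory κ C)
    (hF : IsLexFunctor κ F) (hG : IsLexFunctor κ G) (hH : IsLexFunctor κ H) :
    lexProperty κ C (amalgam f h) :=
  proProperty_le_lexProperty hC _ ⟨(cospanElements f h).Elementsᵒᵖ, inferInstance,
    isCardinalFiltered_op_elements (hC.functor WalkingCospan)
      (isLexFunctor_cospanElements hC hF hG hH), _,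
    (colimit.cocone _).ι, ⟨colimit.isColimit _⟩⟩

namespace amalgam

variable {f h} {D D' : WalkingCospan ⥤ C} {X Y : C}

/-- The element of the amalgam at `X` represented by a map `lim D ⟶ X`, in the component of the
colimit indexed by the cospan `D` with the triple `p`. -/
noncomputable def mk (p : (cospanElements f h).obj D) (k : limit D ⟶ X) : (amalgam f h).obj X :=
  (colimit.ι ((CategoryOfElements.π (cospanElements f h) ⋙ lim).op ⋙ coyoneda)
    (op ⟨D, p⟩)).app X k

lemma map_mk (p : (cospanElements f h).obj D) (k : limit D ⟶ X) (g : X ⟶ Y) :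
    (amalgam f h).map g (mk p k) = mk p (k ≫ g) :=
  (NatTrans.naturality_apply (colimit.ι ((CategoryOfElements.π (cospanElements f h) ⋙ lim).op ⋙
    coyoneda) (op ⟨D, p⟩)) g k).symm

lemma mk_map (p : (cospanElements f h).obj D) (φ : D ⟶ D') (k : limit D' ⟶ X) :
    mk ((cospanElements f h).map φ p) k = mk p (lim.map φ ≫ k) := by
  let x : (cospanElements f h).Elements := ⟨D, p⟩
  let x' : (cospanElements f h).Elements := ⟨D', (cospanElements f h).map φ p⟩
  let ψ : x ⟶ x' := CategoryOfElements.homMk x x' φ rfl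
  have := colimit.w ((CategoryOfElements.π (cospanElements f h) ⋙ lim).op ⋙ coyoneda) ψ.op
  exact (ConcreteCategory.congr_hom (NatTrans.congr_app this X) k).symm

lemma exists_eq_mk (x : (amalgam f h).obj X) :
    ∃ (D : WalkingCospan ⥤ C) (p : (cospanElements f h).obj D) (k : limit D ⟶ X), x = mk p k := by
  obtain ⟨j, k, hk⟩ := Types.jointly_surjective_of_isColimit (isColimitOfPreserves
    ((evaluation C (Type w)).obj X) (colimit.isColimit
      ((CategoryOfElements.π (cospanElements f h) ⋙ lim).op ⋙ coyoneda))) x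
  exact ⟨j.unop.1, j.unop.2, k, hk.symm⟩

lemma exists_of_mk_eq_mk [IsFiltered (cospanElements f h).Elementsᵒᵖ]
    {p : (cospanElements f h).obj D} {k : limit D ⟶ X}
    {p' : (cospanElements f h).obj D'} {k' : limit D' ⟶ X} (hk : mk p k = mk p' k') :
    ∃ (B : WalkingCospan ⥤ C) (q : (cospanElements f h).obj B) (φ : B ⟶ D) (φ' : B ⟶ D'),
      (cospanElements f h).map φ q = p ∧ (cospanElements f h).map φ' q = p' ∧
        lim.map φ ≫ k = lim.map φ' ≫ k' := by
  obtain ⟨j, φ, φ', e⟩ := (Types.FilteredColimit.isColimit_eq_iff _ (isColimitOfPreserves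
    ((evaluation C (Type w)).obj X) (colimit.isColimit
      ((CategoryOfElements.π (cospanElements f h) ⋙ lim).op ⋙ coyoneda)))
    (i := op ⟨D, p⟩) (j := op ⟨D', p'⟩)).1 hk
  exact ⟨j.unop.1, j.unop.2, φ.unop.1, φ'.unop.1, φ.unop.2, φ'.unop.2, e⟩

variable [PreservesFiniteLimits F] [PreservesFiniteLimits G] [PreservesFiniteLimits H]

lemma subsingleton_obj_terminal (K : C ⥤ Type w) [PreservesFiniteLimits K] :
    Subsingleton (K.obj (⊤_ C)) :=
  (Types.isTerminalEquivUnique _ (IsTerminal.isTerminalObj K _ terminalIsTerminal)).instSubsingleton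

/-- The unique element of the value of a finite limit preserving functor at the terminal
object. -/
noncomputable def terminalElement (K : C ⥤ Type w) [PreservesFiniteLimits K] : K.obj (⊤_ C) :=
  (Types.isTerminalEquivUnique _ (IsTerminal.isTerminalObj K _ terminalIsTerminal)).default

/-- An element `a` of `H X`, as a triple on the cospan `X ⟶ ⊤ ⟵ ⊤`. -/
noncomputable def inlElement (a : H.obj X) :
    (cospanElements f h).obj (cospan (terminal.from X) (𝟙 (⊤_ C))) :=
  have := subsingleton_obj_terminal G
  have := subsingleton_obj_terminal H
  ⟨(a, terminalElement F, terminalElement G), Subsingleton.elim (α := H.obj (⊤_ C)) _ _,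
    Subsingleton.elim (α := G.obj (⊤_ C)) _ _⟩

/-- An element `b` of `G X`, as a triple on the cospan `⊤ ⟶ ⊤ ⟵ X`. -/
noncomputable def inrElement (b : G.obj X) :
    (cospanElements f h).obj (cospan (𝟙 (⊤_ C)) (terminal.from X)) :=
  have := subsingleton_obj_terminal G
  have := subsingleton_obj_terminal H
  ⟨(terminalElement H, terminalElement F, b), Subsingleton.elim (α := H.obj (⊤_ C)) _ _,
    Subsingleton.elim (α := G.obj (⊤_ C)) _ _⟩

/-- A map `r : D.left ⟶ X` extends to a map from the cospan `D` to `X ⟶ ⊤ ⟵ ⊤`; hence the image in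
the amalgam of an element of `H X` can be represented in any component from which that element comes. -/
lemma mk_inlElement (p : (cospanElements f h).obj D) (r : D.obj .left ⟶ X) {a : H.obj X}
    (ha : H.map r p.1.1 = a) : mk (inlElement (f := f) (h := h) a)
      (limit.π (cospan (terminal.from X) (𝟙 (⊤_ C))) .left) =
        mk p (limit.π D .left ≫ r) := by
  have := subsingleton_obj_terminal F
  have := subsingleton_obj_terminal G
  let φ : D ⟶ cospan (terminal.from X) (𝟙 (⊤_ C)) :=
    cospanHomMk (terminal.from _) r (terminal.from _) (terminalIsTerminal.hom_ext _ _)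
      (terminalIsTerminal.hom_ext _ _)
  have hφ : (cospanElements f h).map φ p = inlElement (f := f) (h := h) a :=
    Subtype.ext (Prod.ext ha (Prod.ext (Subsingleton.elim (α := F.obj (⊤_ C)) _ _)
      (Subsingleton.elim (α := G.obj (⊤_ C)) _ _)))
  rw [← hφ, mk_map]
  congr 1
  exact limMap_π _ _

lemma mk_inrElement (p : (cospanElements f h).obj D) (r : D.obj .right ⟶ X) {a : G.obj X}
    (ha : G.map r p.1.2.2 = a) : mk (inrElement (f := f) (h := h) a)
      (limit.π (cospan (𝟙 (⊤_ C)) (terminal.from X)) .right) =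
        mk p (limit.π D .right ≫ r) := by
  have := subsingleton_obj_terminal F
  have := subsingleton_obj_terminal H
  let φ : D ⟶ cospan (𝟙 (⊤_ C)) (terminal.from X) :=
    cospanHomMk (terminal.from _) (terminal.from _) r (terminalIsTerminal.hom_ext _ _)
      (terminalIsTerminal.hom_ext _ _)
  have hφ : (cospanElements f h).map φ p = inrElement (f := f) (h := h) a :=
    Subtype.ext (Prod.ext (Subsingleton.elim (α := H.obj (⊤_ C)) _ _)
      (Prod.ext (Subsingleton.elim (α := F.obj (⊤_ C)) _ _) ha))
  rw [← hφ, mk_map]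
  congr 1
  exact limMap_π _ _

variable (f h)

/-- The canonical map from `H` to the amalgam of `f : F ⟶ G` and `h : F ⟶ H`. -/
noncomputable def inl : H ⟶ amalgam f h where
  app X := ↾fun a ↦ mk (inlElement a) (limit.π (cospan (terminal.from X) (𝟙 (⊤_ C))) .left)
  naturality X Y r := by
    ext a
    exact (mk_inlElement (inlElement (f := f) (h := h) a) r rfl).trans (map_mk _ _ _).symm

/-- The canonical map from `G` to the amalgam of `f : F ⟶ G` and `h : F ⟶ H`. -/
noncomputable def inr : G ⟶ amalgam f h where
  app X := ↾fun b ↦ mk (inrElement b) (limit.π (cospan (𝟙 (⊤_ C)) (terminal.from X)) .right)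
  naturality X Y r := by
    ext a
    exact (mk_inrElement (inrElement (f := f) (h := h) a) r rfl).trans (map_mk _ _ _).symm

lemma condition : h ≫ inl f h = f ≫ inr f h := by
  ext X c
  let p : (cospanElements f h).obj (cospan (𝟙 X) (𝟙 X)) :=
    ⟨(h.app X c, c, f.app X c), ConcreteCategory.congr_hom (H.map_id X) _,
      ConcreteCategory.congr_hom (G.map_id X) _⟩
  have h₁ := mk_inlElement p (𝟙 X) (ConcreteCategory.congr_hom (H.map_id X) _)
  have h₂ := mk_inrElement p (𝟙 X) (ConcreteCategory.congr_hom (G.map_id X) _)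
  have h₃ : limit.π (cospan (𝟙 X) (𝟙 X)) .left ≫ 𝟙 X = limit.π (cospan (𝟙 X) (𝟙 X)) .right ≫ 𝟙 X :=
    pullback.condition (f := 𝟙 X) (g := 𝟙 X)
  exact h₁.trans ((congrArg (mk p) h₃).trans h₂.symm)

variable {f h} [IsFiltered (cospanElements f h).Elementsᵒᵖ]

/-- If the image of `a ∈ H Y` in the amalgam comes from an element at `X` along `m : X ⟶ Y`, this
is already seen in one component of the colimit: for some cospan `A ⟶ Z ⟵ B` with a compatible
triple, `a` is the image of the component in `H A` under some `r : A ⟶ Y` whose restriction to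
`A ×_Z B` factors through `m`. -/
lemma exists_of_inl_app_eq_map (m : X ⟶ Y) (a : H.obj Y) (x : (amalgam f h).obj X)
    (hx : (inl f h).app Y a = (amalgam f h).map m x) :
    ∃ (P A Z B : C) (fst : P ⟶ A) (snd : P ⟶ B) (t : A ⟶ Z) (u : B ⟶ Z) (a' : H.obj A)
      (c : F.obj Z) (b : G.obj B) (k : P ⟶ X) (r : A ⟶ Y), IsPullback fst snd t u ∧
      H.map t a' = h.app Z c ∧ G.map u b = f.app Z c ∧ k ≫ m = fst ≫ r ∧ H.map r a' = a := by
  obtain ⟨D, p, k, rfl⟩ := exists_eq_mk x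
  rw [map_mk] at hx
  obtain ⟨B, q, φ, φ', hφ, rfl, e⟩ := exists_of_mk_eq_mk hx
  refine ⟨_, _, _, _, _, _, _, _, q.1.1, q.1.2.1, q.1.2.2, lim.map φ' ≫ k, φ.app .left,
    IsPullback.of_isLimit_cone (limit.isLimit B), q.2.1, q.2.2, ?_, congrArg (fun p ↦ p.1.1) hφ⟩
  rw [Category.assoc, ← e]
  exact limMap_π _ _

/-- If `a ∈ H X` and `b ∈ G X` agree in the amalgam, this is already seen in one component of the
colimit: for some cospan `A ⟶ Z ⟵ B` with a compatible triple, `a` and `b` come from its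
components along maps `A ⟶ X` and `B ⟶ X` that agree on `A ×_Z B`. -/
lemma exists_of_inl_app_eq_inr_app (a : H.obj X) (b : G.obj X)
    (hab : (inl f h).app X a = (inr f h).app X b) :
    ∃ (P A Z B : C) (fst : P ⟶ A) (snd : P ⟶ B) (t : A ⟶ Z) (u : B ⟶ Z) (a' : H.obj A)
      (c : F.obj Z) (b' : G.obj B) (r : A ⟶ X) (s : B ⟶ X), IsPullback fst snd t u ∧
      H.map t a' = h.app Z c ∧ G.map u b' = f.app Z c ∧ fst ≫ r = snd ≫ s ∧
      H.map r a' = a ∧ G.map s b' = b := by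
  obtain ⟨B, q, φ, φ', hφ, hφ', e⟩ := exists_of_mk_eq_mk hab
  refine ⟨_, _, _, _, _, _, _, _, q.1.1, q.1.2.1, q.1.2.2, φ.app .left, φ'.app .right,
    IsPullback.of_isLimit_cone (limit.isLimit B), q.2.1, q.2.2, ?_, congrArg (fun p ↦ p.1.1) hφ,
    congrArg (fun p ↦ p.1.2.2) hφ'⟩
  exact (limMap_π _ _).symm.trans (e.trans (limMap_π _ _))

end amalgam

end

/-! ### Regularity -/

section Regularity

variable {C : Type w} [SmallCategory C] [Regular C] {κ : Cardinal.{w}} [Fact κ.IsRegular]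

section

variable {F G H : C ⥤ Type w} [PreservesFiniteLimits F] [PreservesFiniteLimits G]
  [PreservesFiniteLimits H] {f : F ⟶ G} {h : F ⟶ H}

/-- Immersions are stable under amalgamation. -/
lemma IsImmersion.amalgam_inl (hf : IsImmersion f) [IsFiltered (cospanElements f h).Elementsᵒᵖ] :
    IsImmersion (amalgam.inl f h) := by
  intro V W m _ a x hx
  obtain ⟨P, X, Z, Y, fst, snd, t, u, a, c, b, k, r, sq, ha, hb, hk, rfl⟩ :=
    amalgam.exists_of_inl_app_eq_map m a x hx
  -- Replace `Z` by the image `I` of `Y ⟶ Z` and `X` by `X ×_Z I`: as `f` is an immersion and `f c`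
  -- comes from `G I`, the element `c` comes from `F I`.
  obtain ⟨I, e, n, _, _, rfl⟩ := exists_isRegularEpi_comp_mono u
  obtain ⟨c, rfl⟩ := hf n c (G.map e b) (by rw [← hb, G.map_comp, comp_apply])
  obtain ⟨a', rfl, -⟩ := exists_of_isPullback H (IsPullback.of_hasPullback t n) a (h.app _ c)
    (by rw [ha, NatTrans.naturality_apply])
  let l : pullback (pullback.snd t n) e ⟶ P :=
    sq.lift (pullback.fst _ _ ≫ pullback.fst _ _) (pullback.snd _ _) (by
      rw [Category.assoc, pullback.condition, pullback.condition_assoc])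
  -- The projection `(X ×_Z I) ×_I Y ⟶ X ×_Z I` is a pullback of the regular epimorphism `e`.
  obtain ⟨s, hs⟩ := exists_lift_of_comp_eq (pullback.fst (pullback.snd t n) e) m (l ≫ k)
    (pullback.fst t n ≫ r) (by rw [Category.assoc, hk, sq.lift_fst_assoc, Category.assoc])
  refine ⟨H.map s a', ?_⟩
  rw [← comp_apply, ← H.map_comp, hs, H.map_comp, comp_apply]

/-- If `f : F ⟶ G` is an immersion, then the elements of `G` that are equalized by the two maps to
the amalgam of `f` with itself come from `F`; as `f` is injective, it is the equalizer. -/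
lemma IsImmersion.exists_of_inl_app_eq_inr_app (hf : IsImmersion f)
    [IsFiltered (cospanElements f f).Elementsᵒᵖ] {W : C} (b : G.obj W)
    (hb : (amalgam.inl f f).app W b = (amalgam.inr f f).app W b) :
    ∃ a : F.obj W, f.app W a = b := by
  obtain ⟨P, X, Z, Y, fst, snd, t, u, a, c, b', r, s, sq, ha, hb', hrs, rfl, -⟩ :=
    amalgam.exists_of_inl_app_eq_inr_app b b hb
  -- Replace `Z` by the intersection of the images of `X` and `Y`, and `X` and `Y` by the
  -- preimages of this intersection; as `f` is an immersion, the element `c` comes from it.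
  obtain ⟨I, e₁, m₁, _, _, rfl⟩ := exists_isRegularEpi_comp_mono t
  obtain ⟨J, e₂, m₂, _, _, rfl⟩ := exists_isRegularEpi_comp_mono u
  obtain ⟨c₁, hc₁⟩ := hf m₁ c (G.map e₁ a) (by rw [← ha, G.map_comp, comp_apply])
  obtain ⟨c₂, hc₂⟩ := hf m₂ c (G.map e₂ b') (by rw [← hb', G.map_comp, comp_apply])
  obtain ⟨d, rfl, rfl⟩ := exists_of_isPullback F (IsPullback.of_hasPullback m₁ m₂) c₁ c₂
    (hc₁.trans hc₂.symm)
  let n₁ := pullback.fst m₁ m₂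
  let n₂ := pullback.snd m₁ m₂
  obtain ⟨a', rfl, ha'⟩ := exists_of_isPullback G (IsPullback.of_hasPullback e₁ n₁) a (f.app _ d)
    (by
      apply map_injective_of_mono G m₁
      rw [← comp_apply, ← G.map_comp, ha, ← hc₁, NatTrans.naturality_apply,
        NatTrans.naturality_apply])
  let l : pullback (pullback.snd e₁ n₁) (pullback.snd e₂ n₂) ⟶ P :=
    sq.lift (pullback.fst _ _ ≫ pullback.fst _ _) (pullback.snd _ _ ≫ pullback.fst _ _) (by
      simp only [Category.assoc]
      rw [pullback.condition_assoc, pullback.condition_assoc (f := e₂), pullback.condition_assoc,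
        pullback.condition (f := m₁)])
  -- Both legs of the new cospan are regular epimorphisms, so that `r` and `s` descend to
  -- its vertex.
  obtain ⟨q, hq⟩ := exists_desc_of_pullback (pullback.snd e₁ n₁) (pullback.snd e₂ n₂)
    (pullback.fst e₁ n₁ ≫ r) (pullback.fst e₂ n₂ ≫ s) (by
      have := l ≫= hrs
      rwa [sq.lift_fst_assoc, sq.lift_snd_assoc, Category.assoc, Category.assoc] at this)
  refine ⟨F.map q d, ?_⟩
  rw [NatTrans.naturality_apply, ← ha', ← comp_apply, ← G.map_comp, hq, G.map_comp, comp_apply]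

end

omit [Regular C] in
lemma isFiltered_op_elements_cospanElements (hC : IsLexCategory κ C) {F G H : Lex κ C}
    (f : F ⟶ G) (h : F ⟶ H) : IsFiltered (cospanElements f.hom h.hom).Elementsᵒᵖ :=
  have := isCardinalFiltered_op_elements (hC.functor WalkingCospan)
    (isLexFunctor_cospanElements (f := f.hom) (h := h.hom) hC F.property G.property H.property)
  isFiltered_of_isCardinalFiltered _ κ

/-- The amalgam as an object of `Lex_κ(C, Set)`. -/
noncomputable def lexAmalgam (hC : IsLexCategory κ C) {F G H : Lex κ C} (f : F ⟶ G) (h : F ⟶ H) :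
    Lex κ C :=
  ⟨amalgam f.hom h.hom, lexProperty_amalgam f.hom h.hom hC F.property G.property H.property⟩

lemma isRegularMono_of_isImmersion (hC : IsLexCategory κ C) {F G : Lex κ C} (f : F ⟶ G)
    (hf : IsImmersion f.hom) : IsRegularMono f := by
  have := isFiltered_op_elements_cospanElements hC f f
  let i : G ⟶ lexAmalgam hC f f := ObjectProperty.homMk (amalgam.inl f.hom f.hom)
  let j : G ⟶ lexAmalgam hC f f := ObjectProperty.homMk (amalgam.inr f.hom f.hom)
  have hij : f ≫ i = f ≫ j := ObjectProperty.hom_ext _ (amalgam.condition f.hom f.hom)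
  refine ⟨⟨{ Z := _, left := i, right := j, w := hij, isLimit := Fork.IsLimit.mk' _ fun s ↦ ?_ }⟩⟩
  have hs (X : C) (b : s.pt.obj.obj X) : ∃ a, f.hom.app X a = s.ι.hom.app X b :=
    hf.exists_of_inl_app_eq_inr_app _
      (ConcreteCategory.congr_hom (NatTrans.congr_app (congrArg (·.hom) s.condition) X) b)
  choose l hl using hs
  let l' : s.pt.obj ⟶ F.obj :=
    { app X := ↾(l X)
      naturality X Y g := by
        ext b
        apply hf.injective Y
        refine (hl Y _).trans ?_
        refine Eq.trans ?_ (NatTrans.naturality_apply f.hom g _).symm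
        exact (NatTrans.naturality_apply s.ι.hom g b).trans (congrArg (G.obj.map g) (hl X b).symm) }
  refine ⟨ObjectProperty.homMk l', ?_, fun {m} hm ↦ ?_⟩
  · ext X b
    exact hl X b
  · ext X b
    apply hf.injective X
    exact (ConcreteCategory.congr_hom (NatTrans.congr_app (congrArg (·.hom) hm) X) b).trans
      (hl X b).symm

lemma isRegularEpi_iff_isImmersion (hC : IsLexCategory κ C) {X Y : (Lex κ C)ᵒᵖ} (f : X ⟶ Y) :
    IsRegularEpi f ↔ IsImmersion f.unop.hom :=
  ⟨fun _ ↦ isImmersion_of_strongEpi f,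
    fun h ↦ (isRegularMono_unop_iff_isRegularEpi f).1 (isRegularMono_of_isImmersion hC f.unop h)⟩

/-- Coequalizers in `Lex_κ(C, Set)ᵒᵖ` are equalizers in `Lex_κ(C, Set)`, and all of them exist. -/
lemma regular_op_lex (hC : IsLexCategory κ C) : Regular (Lex κ C)ᵒᵖ := by
  have := hasColimitsOfSize_lex hC
  have := hasLimitsOfSize_lex hC
  have : HasFiniteColimits (Lex κ C) := hasFiniteColimits_of_hasColimitsOfSize _
  have : HasFiniteLimits (Lex κ C) := hasFiniteLimits_of_hasLimitsOfSize _
  exact {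
    hasCoequalizer_of_isKernelPair := fun _ ↦ inferInstance
    regularEpiIsStableUnderBaseChange :=
      { of_isPullback {X Y Y' S} f g f' g' sq hg := by
          change IsRegularEpi _ at hg
          change IsRegularEpi _
          rw [isRegularEpi_iff_isImmersion hC] at hg ⊢
          have := isFiltered_op_elements_cospanElements hC g.unop f.unop
          -- The amalgam is the vertex of a cone over the cospan in `Lex_κ(C, Set)ᵒᵖ`, hence
          -- its `inl` factors through the dual of `g'`.
          let i : op (lexAmalgam hC g.unop f.unop) ⟶ X :=
            (ObjectProperty.homMk (amalgam.inl g.unop.hom f.unop.hom)).op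
          let j : op (lexAmalgam hC g.unop f.unop) ⟶ Y :=
            (ObjectProperty.homMk (amalgam.inr g.unop.hom f.unop.hom)).op
          have hij : j ≫ g = i ≫ f := Quiver.Hom.unop_inj
            (ObjectProperty.hom_ext _ (amalgam.condition g.unop.hom f.unop.hom).symm)
          have hl : g'.unop.hom ≫ (sq.lift j i hij).unop.hom = amalgam.inl g.unop.hom f.unop.hom :=
            congrArg (fun k ↦ k.unop.hom) (sq.lift_snd j i hij)
          exact IsImmersion.of_comp (g := (sq.lift j i hij).unop.hom) (hl ▸ hg.amalgam_inl) } }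

/-- For a regular epimorphism `f` of `C`, that the map induced by `f` on representables is an
immersion is the lifting property of `f` with respect to monomorphisms. -/
lemma isRegularFunctor_yonedaLex (hC : IsLexCategory κ C) : IsRegularFunctor (yonedaLex κ C) where
  preservesFiniteLimits := isLexFunctor_yonedaLex.preservesFiniteLimits
  map_isRegularEpi {X Y} f _ := by
    rw [isRegularEpi_iff_isImmersion hC]
    intro V W m _ a b hab
    exact exists_lift_of_comp_eq f m b a hab.symm

end Regularity

end KappaLex

open KappaLex

theorem mainTheorem5 (κ : Cardinal.{w}) [Fact κ.IsRegular] (C : Type w) [SmallCategory C]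
    (hC : KappaLex.IsLexCategory κ C) [Regular C] :
    -- `Lex_κ(C, Set)ᵒᵖ` and `Pro_κ(C)` are the same full subcategory of `(C ⥤ Set)ᵒᵖ`
    KappaLex.lexProperty κ C = KappaLex.proProperty κ C ∧
    -- it is `κ`-lex and regular
    (KappaLex.IsLexCategory κ (KappaLex.Lex κ C)ᵒᵖ ∧ Regular (KappaLex.Lex κ C)ᵒᵖ) ∧
    (KappaLex.IsLexCategory κ (KappaLex.Pro κ C) ∧ Regular (KappaLex.Pro κ C)) ∧
    -- the Yoneda embedding into it is fully faithful, `κ`-lex and regular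
    ((KappaLex.yonedaLex κ C).Full ∧ (KappaLex.yonedaLex κ C).Faithful ∧
      KappaLex.IsLexFunctor κ (KappaLex.yonedaLex κ C) ∧
      KappaLex.IsRegularFunctor (KappaLex.yonedaLex κ C)) ∧
    ((KappaLex.yonedaPro κ C).Full ∧ (KappaLex.yonedaPro κ C).Faithful ∧
      KappaLex.IsLexFunctor κ (KappaLex.yonedaPro κ C) ∧
      KappaLex.IsRegularFunctor (KappaLex.yonedaPro κ C)) := by
  have hpro := lexProperty_eq_proProperty hC
  have hcat := And.intro (isLexCategory_op_lex hC) (regular_op_lex hC)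
  have hY : (yonedaLex κ C).Full ∧ (yonedaLex κ C).Faithful ∧ IsLexFunctor κ (yonedaLex κ C) ∧
      IsRegularFunctor (yonedaLex κ C) :=
    ⟨inferInstance, inferInstance, isLexFunctor_yonedaLex, isRegularFunctor_yonedaLex hC⟩
  refine ⟨hpro, hcat, ?_, hY, ?_⟩
  · unfold Pro
    rwa [← hpro]
  · -- The objects of `Pro κ C` carry a proof of another, equal, property: generalize over it.
    have key (P : ObjectProperty (C ⥤ Type w)) (hP : ∀ X, P (coyoneda.obj X))
        (h : lexProperty κ C = P) :
        (P.lift coyoneda hP).rightOp.Full ∧ (P.lift coyoneda hP).rightOp.Faithful ∧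
          IsLexFunctor κ (P.lift coyoneda hP).rightOp ∧
          IsRegularFunctor (P.lift coyoneda hP).rightOp := by
      subst h
      exact hY
    exact key _ (proProperty_coyoneda κ C) hpro
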